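/- Let $F$ be a field of prime characteristic $p$. For $n\geq 1$ let $J_n$ denote the $n\times n$ matrix over $F$ with $1$s in positions $(i,i)$ for $1\leq i\leq n$ and $(i,i+1)$ for $1\leq i<n$, and zeros elsewhere. For integers $1\leq r\leq s$ let $\lambda(r,s,p)=(\lambda_1,\lambda_2,\dots)$, with $\lambda_1\geq\lambda_2\geq\cdots>0$, be the partition of $rs$ such that the Jordan canonical form of $J_r\otimes J_s$ is $J_{\lambda_1}\oplus J_{\lambda_2}\oplus\cdots$. Suppose that $1\leq r\leq s$ and that $s\not\equiv j\pmod p$ for every integer $j$ with $|j|\leq r-2$, that is, $s\not\equiv 0,\pm1,\pm2,\dots,\pm(r-2)\pmod p$ (no condition when $r=1$). Then $\lambda(r,s,p)$ is the standard partition: it has exactly $r$ parts, and its $i$th part is $\lambda_i=r+s+1-2i$ for $1\leq i\leq r$. -/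

import Mathlib

/-- The `n × n` unipotent Jordan block `J_n`, with `1`s in the positions `(i, i)` and `(i, i + 1)`
and zeros elsewhere. -/
def jordanBlock (F : Type*) [Field F] (n : ℕ) : Matrix (Fin n) (Fin n) F :=
  Matrix.of fun i j => if j = i ∨ (j : ℕ) = (i : ℕ) + 1 then 1 else 0

/-- The direct sum `J_{λ₁} ⊕ ⋯ ⊕ J_{λₖ}` of unipotent Jordan blocks, for `lam = [λ₁, …, λₖ]`. -/
def jordanSum (F : Type*) [Field F] (lam : List ℕ) :
    Matrix (Σ i : Fin lam.length, Fin (lam.get i)) (Σ i : Fin lam.length, Fin (lam.get i)) F :=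
  Matrix.blockDiagonal' fun i => jordanBlock F (lam.get i)

/-- `lam = [λ₁, …, λₖ]` with `λ₁ ≥ ⋯ ≥ λₖ > 0`, and the square matrix `A` is similar to
`J_{λ₁} ⊕ ⋯ ⊕ J_{λₖ}`. The two matrices have different index types, so the change of basis `P`
and its inverse `Q` are matrices between these index types. -/
def IsJordanPartition {F : Type*} [Field F] {m : Type*} [Fintype m] [DecidableEq m]
    (A : Matrix m m F) (lam : List ℕ) : Prop :=
  lam.Pairwise (· ≥ ·) ∧ (∀ a ∈ lam, 0 < a) ∧
    ∃ (P : Matrix m (Σ i : Fin lam.length, Fin (lam.get i)) F)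
      (Q : Matrix (Σ i : Fin lam.length, Fin (lam.get i)) m F),
      P * Q = 1 ∧ Q * P = 1 ∧ A = P * jordanSum F lam * Q

open Classical in
/-- The Jordan partition `λ(r, s, p)`, for `p` the characteristic of `F`: the unique list
`λ₁ ≥ ⋯ ≥ λₖ > 0` such that the Jordan canonical form of `J_r ⊗ J_s` over `F` is
`J_{λ₁} ⊕ ⋯ ⊕ J_{λₖ}`. (The value is the empty list if there is no such list, or more than one;
an equation with a nonempty list therefore also asserts existence and uniqueness.) -/
noncomputable def jordanPartition (F : Type*) [Field F] (r s : ℕ) : List ℕ :=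
  if h : ∃! lam : List ℕ,
      IsJordanPartition (Matrix.kronecker (jordanBlock F r) (jordanBlock F s)) lam
  then h.choose else []

/-- The standard partition of `r * s`, for `1 ≤ r ≤ s`: it has `r` parts, and its `i`-th part is
`r + s + 1 - 2 * i` for `1 ≤ i ≤ r` (below, the index `i : Fin r` starts from `0`; the subtraction
does not truncate when `r ≤ s`). -/
def standardPartition (r s : ℕ) : List ℕ :=
  List.ofFn fun i : Fin r => r + s + 1 - 2 * ((i : ℕ) + 1)

/-! ### Uniqueness of the Jordan partition -/

/-! In `F[x, y] / (x ^ r, y ^ s)`, multiplication by `(1 + x) * (1 + y)` has matrix `J_r ⊗ J_s` in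
the monomial basis. It equals `1 + z` with `z = x + y'` and `y' = y * (1 + x)`. The monomials in `x`
and `y'` also form a basis and `y' ^ s = 0`, so the Jordan type sought is that of a sum of the two
generators, which is homogeneous for the grading by degree in `x, y'`.

For each `i < r` there is a form `v i` of degree `i` with `z ^ (r + s - 1 - 2 * i) * v i = 0`: this
is `i` linear equations in `i + 1` coefficients. One power of `z` lower, vanishing would give `i +
1` equations, whose matrix of binomial coefficients is nonsingular exactly because of the congruence
hypothesis (`eq_zero_of_sum_mul_choose_eq_zero`). The last nonzero vectors of the strings lie in
distinct degrees, so they are independent, hence so are the whole strings; the lengths sum to `r *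
s`, so the strings form a Jordan basis (`exists_strings`).

`jordanPartition` also requires uniqueness, which follows from the ranks of the powers of `A - 1`.
-/

theorem jordanBlock_sub_one_pow_apply (F : Type*) [Field F] (n k : ℕ) (i j : Fin n) :
    ((jordanBlock F n - 1) ^ k) i j = if (j : ℕ) = (i : ℕ) + k then 1 else 0 := by
  have h1 : ∀ i j : Fin n,
      (jordanBlock F n - 1) i j = if (j : ℕ) = (i : ℕ) + 1 then 1 else 0 := by
    intro i j
    simp only [jordanBlock, Matrix.sub_apply, Matrix.of_apply, Matrix.one_apply, Fin.ext_iff]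
    by_cases h : (i : ℕ) = j
    · simp [h]
    · simp [h, Ne.symm h]
  induction k generalizing i j with
  | zero => simp [Matrix.one_apply, Fin.ext_iff, eq_comm]
  | succ k ih =>
    rw [pow_succ, Matrix.mul_apply]
    simp only [ih, h1]
    by_cases h : (i : ℕ) + k < n
    · rw [Finset.sum_eq_single ⟨i + k, h⟩]
      · simp [add_assoc]
      · intro b _ hb
        rw [if_neg (fun h' => hb (Fin.ext h')), zero_mul]
      · simp
    · rw [if_neg (by have := j.2; omega)]
      refine Finset.sum_eq_zero fun b _ => ?_
      rw [if_neg (by have := b.2; omega), zero_mul]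

theorem jordanSum_sub_one_pow (F : Type*) [Field F] (lam : List ℕ) (k : ℕ) :
    (jordanSum F lam - 1) ^ k =
      Matrix.blockDiagonal' fun i => (jordanBlock F (lam.get i) - 1) ^ k := by
  rw [jordanSum, ← Matrix.blockDiagonal'_one, ← Matrix.blockDiagonal'_sub,
    ← Matrix.blockDiagonal'_pow]
  rfl

theorem jordanSum_sub_one_pow_mulVec (F : Type*) [Field F] (lam : List ℕ) (k : ℕ)
    (v : (Σ i : Fin lam.length, Fin (lam.get i)) → F) (i : Fin lam.length)
    (l : Fin (lam.get i)) :
    ((jordanSum F lam - 1) ^ k).mulVec v ⟨i, l⟩ =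
      if h : (l : ℕ) + k < lam.get i then v ⟨i, ⟨l + k, h⟩⟩ else 0 := by
  rw [jordanSum_sub_one_pow, Matrix.mulVec, dotProduct, Fintype.sum_sigma,
    Finset.sum_eq_single i]
  · simp only [Matrix.blockDiagonal'_apply_eq, jordanBlock_sub_one_pow_apply]
    split_ifs with h
    · rw [Finset.sum_eq_single ⟨l + k, h⟩]
      · simp
      · intro b _ hb
        rw [if_neg (fun h' => hb (Fin.ext h')), zero_mul]
      · simp
    · refine Finset.sum_eq_zero fun b _ => ?_
      rw [if_neg (by have := b.2; omega), zero_mul]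
  · intro b _ hb
    refine Finset.sum_eq_zero fun c _ => ?_
    rw [Matrix.blockDiagonal'_apply_ne _ _ _ hb.symm, zero_mul]
  · simp

/-- The power shifts each block by `k`, so it has the same kernel as restriction to the positions `l
≥ k`, which is surjective. -/
theorem rank_jordanSum_sub_one_pow (F : Type*) [Field F] (lam : List ℕ) (k : ℕ) :
    ((jordanSum F lam - 1) ^ k).rank =
      Fintype.card {q : Σ i : Fin lam.length, Fin (lam.get i) // k ≤ (q.2 : ℕ)} := by
  set M := (jordanSum F lam - 1) ^ k with hM
  set f := LinearMap.funLeft F F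
    (Subtype.val : {q : Σ i : Fin lam.length, Fin (lam.get i) // k ≤ (q.2 : ℕ)} → _) with hf
  have hker : LinearMap.ker M.mulVecLin = LinearMap.ker f := by
    ext v
    simp only [LinearMap.mem_ker, Matrix.mulVecLin_apply, funext_iff]
    constructor
    · rintro h ⟨⟨i, l⟩, hl⟩
      have hl' : k ≤ (l : ℕ) := hl
      have h1 := h ⟨i, ⟨l - k, by have := l.2; omega⟩⟩
      rw [hM, jordanSum_sub_one_pow_mulVec, dif_pos (by have := l.2; simp only; omega)] at h1
      simpa [hf, LinearMap.funLeft_apply, Nat.sub_add_cancel hl'] using h1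
    · rintro h ⟨i, l⟩
      rw [hM, jordanSum_sub_one_pow_mulVec]
      split_ifs with hl
      · exact h ⟨⟨i, ⟨l + k, hl⟩⟩, Nat.le_add_left _ _⟩
      · rfl
  have h1 := M.mulVecLin.finrank_range_add_finrank_ker
  have h2 := f.finrank_range_add_finrank_ker
  rw [LinearMap.range_eq_top.2
    (LinearMap.funLeft_surjective_of_injective F F _ Subtype.val_injective), finrank_top,
    Module.finrank_fintype_fun_eq_card] at h2
  rw [hker] at h1
  rw [Matrix.rank]
  omega

/-- Consecutive ranks differ by the number of parts exceeding `k`, so the ranks determine the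
partition. -/
theorem card_le_snd_eq_add (lam : List ℕ) (k : ℕ) :
    Fintype.card {q : Σ i : Fin lam.length, Fin (lam.get i) // k ≤ (q.2 : ℕ)} =
      Fintype.card {q : Σ i : Fin lam.length, Fin (lam.get i) // k + 1 ≤ (q.2 : ℕ)} +
        lam.countP (k < ·) := by
  induction lam with
  | nil =>
    have (k : ℕ) :
      IsEmpty {q : Σ i : Fin ([] : List ℕ).length, Fin ([].get i) // k ≤ (q.2 : ℕ)} :=
      ⟨fun q => q.1.1.elim0⟩
    simp
  | cons a t ih =>
    have key (k : ℕ) :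
        Fintype.card {q : Σ i : Fin (a :: t).length, Fin ((a :: t).get i) // k ≤ (q.2 : ℕ)} =
          (a - k) +
            Fintype.card {q : Σ i : Fin t.length, Fin (t.get i) // k ≤ (q.2 : ℕ)} := by
      simp only [Fintype.card_subtype, ← Finset.univ_sigma_univ, Finset.card_filter,
        Finset.sum_sigma]
      have hs := Fin.sum_univ_succ (n := t.length) (fun i : Fin (t.length + 1) =>
        ∑ l : Fin ((a :: t).get i), if k ≤ (l : ℕ) then 1 else 0)
      refine hs.trans ?_
      congr 1
      change (∑ l : Fin a, if k ≤ (l : ℕ) then 1 else 0) = a - k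
      rw [Fin.sum_univ_eq_sum_range (fun l => if k ≤ l then 1 else 0) a, ← Finset.card_filter]
      have : (Finset.range a).filter (fun l => k ≤ l) = Finset.Ico k a := by
        ext; simp [and_comm]
      rw [this, Nat.card_Ico]
    rw [key, key, ih, List.countP_cons]
    by_cases h : k < a
    · simp only [h, decide_true, if_true]; omega
    · simp only [h, decide_false]; simp; omega

theorem eq_of_pairwise_ge_of_countP_eq {l₁ l₂ : List ℕ} (h₁ : l₁.Pairwise (· ≥ ·))
    (h₂ : l₂.Pairwise (· ≥ ·)) (p₁ : ∀ a ∈ l₁, 0 < a) (p₂ : ∀ a ∈ l₂, 0 < a)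
    (h : ∀ k, l₁.countP (k < ·) = l₂.countP (k < ·)) : l₁ = l₂ := by
  refine List.Perm.eq_of_pairwise (fun a b _ _ hab hba => le_antisymm hba hab) h₁ h₂ ?_
  rw [List.perm_iff_count]
  rintro (_ | k)
  · rw [List.count_eq_zero_of_not_mem fun h => (p₁ 0 h).false,
      List.count_eq_zero_of_not_mem fun h => (p₂ 0 h).false]
  · have key (l : List ℕ) :
        l.countP (k < ·) = l.countP (k + 1 < ·) + l.count (k + 1) := by
      induction l with
      | nil => rfl
      | cons a t ih =>
        simp only [List.countP_cons, List.count_cons, ih, decide_eq_true_eq, beq_iff_eq]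
        split_ifs <;> omega
    have h1 := h k
    rw [key, key l₂, h (k + 1)] at h1
    omega

theorem IsJordanPartition.rank_sub_one_pow {F : Type*} [Field F] {m : Type*} [Fintype m]
    [DecidableEq m] {A : Matrix m m F} {lam : List ℕ} (h : IsJordanPartition A lam) (k : ℕ) :
    ((A - 1) ^ k).rank =
      Fintype.card {q : Σ i : Fin lam.length, Fin (lam.get i) // k ≤ (q.2 : ℕ)} := by
  obtain ⟨-, -, P, Q, hPQ, hQP, hA⟩ := h
  rw [← rank_jordanSum_sub_one_pow F lam k]
  have h0 : A - 1 = P * (jordanSum F lam - 1) * Q := by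
    rw [Matrix.mul_sub, Matrix.sub_mul, Matrix.mul_one, hPQ, hA]
  have h1 : (A - 1) ^ k = P * (jordanSum F lam - 1) ^ k * Q := by
    induction k with
    | zero => simp [hPQ]
    | succ k ih =>
      rw [pow_succ, ih, h0, pow_succ]
      simp only [Matrix.mul_assoc]
      rw [← Matrix.mul_assoc Q P, hQP, Matrix.one_mul]
  have h2 : (jordanSum F lam - 1) ^ k = Q * (A - 1) ^ k * P := by
    rw [h1]
    simp only [Matrix.mul_assoc]
    rw [hQP, Matrix.mul_one, ← Matrix.mul_assoc, hQP, Matrix.one_mul]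
  apply le_antisymm
  · rw [h1]
    exact (Matrix.rank_mul_le_left _ _).trans (Matrix.rank_mul_le_right _ _)
  · conv_lhs => rw [h2]
    exact (Matrix.rank_mul_le_left _ _).trans (Matrix.rank_mul_le_right _ _)

theorem IsJordanPartition.unique {F : Type*} [Field F] {m : Type*} [Fintype m]
    [DecidableEq m] {A : Matrix m m F} {lam mu : List ℕ} (h : IsJordanPartition A lam)
    (h' : IsJordanPartition A mu) : lam = mu := by
  refine eq_of_pairwise_ge_of_countP_eq h.1 h'.1 h.2.1 h'.2.1 fun k => ?_
  have h1 := card_le_snd_eq_add lam k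
  have h2 := card_le_snd_eq_add mu k
  rw [← h.rank_sub_one_pow, ← h.rank_sub_one_pow] at h1
  rw [← h'.rank_sub_one_pow, ← h'.rank_sub_one_pow] at h2
  omega

theorem jordanPartition_eq {F : Type*} [Field F] {r s : ℕ} {lam : List ℕ}
    (h : IsJordanPartition (Matrix.kronecker (jordanBlock F r) (jordanBlock F s)) lam) :
    jordanPartition F r s = lam := by
  have hex : ∃! lam : List ℕ,
      IsJordanPartition (Matrix.kronecker (jordanBlock F r) (jordanBlock F s)) lam :=
    ⟨lam, h, fun _ h' => h'.unique h⟩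
  rw [jordanPartition, dif_pos hex]
  exact hex.choose_spec.1.unique h

/-! ### Nonsingularity of matrices of binomial coefficients -/

/-- Up to the factor `(m + k)!`, the entry is `(N + j).descFactorial m` times a monic polynomial of
degree `k` in `N + j - m`: a row scaling of a matrix with Vandermonde determinant. -/
theorem eq_zero_of_sum_mul_choose_eq_zero {F : Type*} [Field F] (N m n : ℕ) (c : Fin n → F)
    (hinj : Function.Injective fun j : Fin n => ((N + j : ℕ) : F))
    (hne : ∀ j : Fin n, ((N + j).descFactorial m : F) ≠ 0)
    (h : ∀ k : Fin n, ∑ j : Fin n, c j * ((N + j).choose (m + k) : F) = 0) : c = 0 := by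
  have hmat : (Matrix.of fun j k : Fin n =>
      (descPochhammer F k).eval (((N + j : ℕ) : F) - (m : F))).det ≠ 0 := by
    rw [← Matrix.det_eval_matrixOfPolynomials_eq_det_vandermonde
      (fun j : Fin n => ((N + j : ℕ) : F) - (m : F)) (fun k : Fin n => descPochhammer F k)
      (fun k => descPochhammer_natDegree F k) (fun k => monic_descPochhammer F k)]
    rw [Matrix.det_vandermonde_ne_zero_iff]
    intro a b hab
    exact hinj (sub_left_injective hab)
  have hd : (fun j : Fin n => c j * ((N + j).descFactorial m : F)) = 0 := by
    refine Matrix.eq_zero_of_vecMul_eq_zero hmat ?_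
    funext k
    -- The equations are only multiplied by the factorial, so it need not be invertible in `F`.
    have hk := congrArg (((m + k).factorial : F) * ·) (h k)
    simp only [mul_zero, Finset.mul_sum] at hk
    refine Eq.trans ?_ hk
    simp only [Matrix.vecMul, dotProduct, Matrix.of_apply]
    refine Finset.sum_congr rfl fun j _ => ?_
    have e1 : ((N + j).descFactorial (m + k) : F) =
        (N + j).descFactorial m * (descPochhammer F k).eval (((N + j : ℕ) : F) - (m : F)) := by
      have := congrArg (Polynomial.eval ((N + j : ℕ) : F)) (descPochhammer_mul F m k)
      rw [Polynomial.eval_mul, Polynomial.eval_comp, descPochhammer_eval_eq_descFactorial,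
        descPochhammer_eval_eq_descFactorial] at this
      rw [← this]
      simp
    rw [mul_assoc, ← e1, Nat.descFactorial_eq_factorial_mul_choose]
    push_cast
    ring
  funext j
  exact (mul_eq_zero.1 (congrFun hd j)).resolve_right (hne j)

theorem exists_ne_zero_sum_mul_choose_eq_zero (F : Type*) [Field F] (N m n : ℕ) :
    ∃ c : Fin (n + 1) → F, c ≠ 0 ∧
      ∀ k < n, ∑ j : Fin (n + 1), c j * ((N + j).choose (m + k) : F) = 0 := by
  have h := LinearMap.ker_ne_bot_of_finrank_lt (K := F)
    (f := (Matrix.of fun (k : Fin n) (j : Fin (n + 1)) =>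
      ((N + j).choose (m + k) : F)).mulVecLin) (by simp)
  obtain ⟨c, hc, hc0⟩ := Submodule.exists_mem_ne_zero_of_ne_bot h
  refine ⟨c, hc0, fun k hk => ?_⟩
  have := congrFun (LinearMap.mem_ker.1 hc) ⟨k, hk⟩
  simpa [Matrix.mulVec, dotProduct, mul_comm] using this

/-- If `p < r`, the residue `s % p ≤ r - 2` would itself be an excluded `j`. -/
theorem le_of_forall_not_modEq {p r s : ℕ} (hp : p ≠ 0)
    (hs : ∀ j : ℤ, |j| ≤ (r : ℤ) - 2 → ¬ (s : ℤ) ≡ j [ZMOD (p : ℤ)]) : r ≤ p := by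
  by_contra! h
  refine hs ((s % p : ℕ) : ℤ) ?_ ?_
  · have := Nat.mod_lt s (Nat.pos_of_ne_zero hp)
    rw [abs_of_nonneg (by positivity)]
    omega
  · push_cast
    exact (Int.mod_modEq _ _).symm

theorem injective_natCast_add {F : Type*} [Field F] {p : ℕ} [CharP F p] (N : ℕ) {n : ℕ}
    (hn : n ≤ p) : Function.Injective fun j : Fin n => ((N + j : ℕ) : F) := by
  intro a b hab
  have h := (CharP.natCast_eq_natCast F p).1 hab
  have h2 := Nat.ModEq.add_left_cancel' N h
  exact Fin.ext (Nat.ModEq.eq_of_lt_of_lt h2 (a.2.trans_le hn) (b.2.trans_le hn))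

theorem descFactorial_natCast_ne_zero {F : Type*} [Field F] {N m : ℕ}
    (h : ∀ u < m, ((N - u : ℕ) : F) ≠ 0) : (N.descFactorial m : F) ≠ 0 := by
  rw [Nat.descFactorial_eq_prod_range]
  push_cast
  exact Finset.prod_ne_zero_iff.2 fun u hu => h u (Finset.mem_range.1 hu)

/-- Each factor is `s + t` with `t = r - 2 - 2 * i + j - u` and `|t| ≤ r - 2`; these are the
residues that the hypothesis excludes. -/
theorem descFactorial_natCast_ne_zero_of_not_modEq {F : Type*} [Field F] {p : ℕ} [CharP F p]
    {r s i j : ℕ} (hrs : r ≤ s) (hi : i < r) (hj : j ≤ i)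
    (hs : ∀ j : ℤ, |j| ≤ (r : ℤ) - 2 → ¬ (s : ℤ) ≡ j [ZMOD (p : ℤ)]) :
    ((r + s - 2 - 2 * i + j).descFactorial (r - 1 - i) : F) ≠ 0 := by
  refine descFactorial_natCast_ne_zero fun u hu h => ?_
  rw [CharP.cast_eq_zero_iff F p] at h
  refine hs (-((r : ℤ) - 2 - 2 * i + j - u)) ?_ ?_
  · rw [abs_le]; omega
  · rw [Int.modEq_comm, Int.modEq_iff_dvd]
    obtain ⟨d, hd⟩ := h
    refine ⟨d, ?_⟩
    rw [← Nat.cast_mul, ← hd]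
    omega

/-! ### Strings of a nilpotent element -/

/-- In a nontrivial relation let `d` be the largest offset carrying a nonzero coefficient.
Multiplying by `z ^ d` kills the terms of smaller offset and moves those of offset `d` to the ends
of their strings. -/
theorem linearIndependent_pow_mul_of_linearIndependent {F A ι : Type*} [Field F] [CommRing A]
    [Algebra F A] [Fintype ι] (z : A) (n : ι → ℕ) (v : ι → A) (hz : ∀ i, z ^ n i * v i = 0)
    (hli : LinearIndependent F fun i => z ^ (n i - 1) * v i) :
    LinearIndependent F fun q : Σ i, Fin (n i) => z ^ (n q.1 - 1 - q.2) * v q.1 := by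
  classical
  rw [Fintype.linearIndependent_iff]
  intro g hg
  by_contra! hne
  obtain ⟨q₁, hq₁⟩ := hne
  obtain ⟨q₀, hq₀, hmax⟩ := Finset.exists_max_image
    (Finset.univ.filter fun q : Σ i, Fin (n i) => g q ≠ 0) (fun q => (q.2 : ℕ)) ⟨q₁, by simpa⟩
  simp only [Finset.mem_filter, Finset.mem_univ, true_and] at hq₀ hmax
  obtain ⟨d, hd⟩ : ∃ d : ℕ, d = q₀.2 := ⟨_, rfl⟩
  rw [← hd] at hmax
  have hzero : ∀ (i : ι) (e : ℕ), n i ≤ e → z ^ e * v i = 0 := by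
    intro i e he
    rw [← Nat.sub_add_cancel he, pow_add, mul_assoc, hz, mul_zero]
  have hsum : ∑ i, (if h : d < n i then g ⟨i, d, h⟩ else 0) • (z ^ (n i - 1) * v i) = 0 := by
    have h1 := congrArg (z ^ d * ·) hg
    simp only [mul_zero, Finset.mul_sum, Fintype.sum_sigma] at h1
    rw [← h1]
    refine Finset.sum_congr rfl fun i _ => ?_
    have hterm (l : Fin (n i)) (hl : (l : ℕ) ≠ d) :
        z ^ d * g ⟨i, l⟩ • (z ^ (n i - 1 - l) * v i) = 0 := by
      rcases lt_or_gt_of_ne hl with h | h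
      · rw [mul_smul_comm, ← mul_assoc, ← pow_add, hzero i _ (by have := l.2; omega), smul_zero]
      · have : g ⟨i, l⟩ = 0 := by
          by_contra h0
          exact absurd (hmax _ h0) (not_le.2 h)
        rw [this, zero_smul, mul_zero]
    split_ifs with h
    · rw [Finset.sum_eq_single ⟨d, h⟩ (fun l _ hl => hterm l fun h' => hl (Fin.ext h')) (by simp),
        mul_smul_comm, ← mul_assoc, ← pow_add]
      congr 4
      simp only; omega
    · rw [zero_smul, Finset.sum_eq_zero fun l _ => hterm l (by have := l.2; omega)]
  have h2 := Fintype.linearIndependent_iff.1 hli _ hsum q₀.1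
  subst hd
  rw [dif_pos q₀.2.2] at h2
  exact hq₀ h2

section Strings

variable {F A : Type*} [Field F] [CommRing A] [Algebra F A]

theorem add_pow_mul_sum_smul (x y : A) (M i : ℕ) (c : Fin (i + 1) → F) :
    (x + y) ^ M * ∑ j : Fin (i + 1), c j • ((x + y) ^ (j : ℕ) * y ^ (i - j)) =
      ∑ a ∈ Finset.range (M + i + 1),
        (∑ j : Fin (i + 1), c j * ((M + j).choose a : F)) • (x ^ a * y ^ (M + i - a)) := by
  simp only [Finset.mul_sum, Finset.sum_smul]
  rw [Finset.sum_comm]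
  refine Finset.sum_congr rfl fun j _ => ?_
  have hj := j.2
  rw [mul_smul_comm, ← mul_assoc, ← pow_add, add_pow, Finset.sum_mul, Finset.smul_sum]
  rw [← Finset.sum_subset (Finset.range_mono (show M + j + 1 ≤ M + i + 1 by omega))]
  · refine Finset.sum_congr rfl fun a ha => ?_
    have ha' := Finset.mem_range.1 ha
    rw [show M + i - a = (M + j - a) + (i - j) by omega, pow_add, mul_smul]
    congr 1
    rw [Algebra.smul_def, map_natCast]
    ring
  · intro a _ ha
    rw [Nat.choose_eq_zero_of_lt (by simpa using ha)]
    simp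

theorem repr_sum_smul {r s : ℕ} {x y : A} (hx : x ^ r = 0) (hy : y ^ s = 0)
    (B : Module.Basis (Fin r × Fin s) F A) (hB : ∀ q, B q = x ^ (q.1 : ℕ) * y ^ (q.2 : ℕ))
    (D : ℕ) (c : ℕ → F) (a : Fin r) (b : Fin s) :
    B.repr (∑ a ∈ Finset.range (D + 1), c a • (x ^ a * y ^ (D - a))) (a, b) =
      if (a : ℕ) + b = D then c a else 0 := by
  have hterm (a' : ℕ) : B.repr (x ^ a' * y ^ (D - a')) (a, b) =
      if a' = a ∧ D - a' = b then 1 else 0 := by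
    by_cases h1 : a' < r
    · by_cases h2 : D - a' < s
      · rw [← hB (⟨a', h1⟩, ⟨D - a', h2⟩), B.repr_self, Finsupp.single_apply]
        simp [Prod.ext_iff, Fin.ext_iff]
      · rw [← Nat.sub_add_cancel (not_lt.1 h2), pow_add y, hy,
          if_neg (by have := b.2; omega)]
        simp
    · rw [← Nat.sub_add_cancel (not_lt.1 h1), pow_add, hx, if_neg (by have := a.2; omega)]
      simp
  simp only [map_sum, map_smul, Finsupp.finsetSum_apply, Finsupp.smul_apply, hterm, smul_eq_mul]
  split_ifs with h
  · rw [Finset.sum_eq_single (a : ℕ)]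
    · rw [if_pos ⟨rfl, by omega⟩, mul_one]
    · intro a' _ ha'
      rw [if_neg (fun h' => ha' h'.1), mul_zero]
    · intro h'
      exact absurd (Finset.mem_range.2 (by omega)) h'
  · refine Finset.sum_eq_zero fun a' ha' => ?_
    have := Finset.mem_range.1 ha'
    rw [if_neg (by omega), mul_zero]

/-- A monomial `x ^ a * y ^ b` of degree `r + s - 1 - i` can be nonzero only for `r - i ≤ a < r`,
and one of degree `r + s - 2 - i` only for `r - 1 - i ≤ a < r`. This gives `i` and `i + 1`
coefficients respectively. -/
theorem exists_strings {p r s : ℕ} [CharP F p] (hp : p ≠ 0) (hrs : r ≤ s)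
    (hs : ∀ j : ℤ, |j| ≤ (r : ℤ) - 2 → ¬ (s : ℤ) ≡ j [ZMOD (p : ℤ)])
    {x y : A} (hx : x ^ r = 0) (hy : y ^ s = 0)
    (B : Module.Basis (Fin r × Fin s) F A) (hB : ∀ q, B q = x ^ (q.1 : ℕ) * y ^ (q.2 : ℕ)) :
    ∃ v : Fin r → A, (∀ i : Fin r, (x + y) ^ (r + s - 1 - 2 * (i : ℕ)) * v i = 0) ∧
      LinearIndependent F fun i : Fin r => (x + y) ^ (r + s - 2 - 2 * (i : ℕ)) * v i := by
  have hrp : r ≤ p := le_of_forall_not_modEq hp hs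
  choose c hc0 hc using fun i : Fin r =>
    exists_ne_zero_sum_mul_choose_eq_zero F (r + s - 1 - 2 * (i : ℕ)) (r - i) i
  refine ⟨fun i => ∑ j : Fin (i + 1), c i j • ((x + y) ^ (j : ℕ) * y ^ ((i : ℕ) - j)), ?_, ?_⟩
  · intro i
    have hi := i.2
    rw [add_pow_mul_sum_smul]
    refine Finset.sum_eq_zero fun a ha => ?_
    by_cases h1 : r ≤ a
    · rw [← Nat.sub_add_cancel h1, pow_add, hx, mul_zero, zero_mul, smul_zero]
    by_cases h2 : s ≤ r + s - 1 - 2 * (i : ℕ) + i - a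
    · rw [← Nat.sub_add_cancel h2, pow_add y, hy, mul_zero, mul_zero, smul_zero]
    have h3 := hc i (a - (r - i)) (by omega)
    rw [show r - i + (a - (r - i)) = a by omega] at h3
    rw [h3, zero_smul]
  · rw [Fintype.linearIndependent_iff]
    intro g hg i
    have hi := i.2
    obtain ⟨k, hk⟩ : ∃ k : Fin (i + 1), ∑ j : Fin (i + 1),
        c i j * ((r + s - 2 - 2 * (i : ℕ) + j).choose (r - 1 - i + k) : F) ≠ 0 := by
      by_contra! h
      exact hc0 i (eq_zero_of_sum_mul_choose_eq_zero _ _ _ (c i)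
        (injective_natCast_add (p := p) _ (by omega))
        (fun j => descFactorial_natCast_ne_zero_of_not_modEq hrs hi (by omega) hs) h)
    have hk2 := k.2
    -- This monomial has degree `r + s - 2 - i`, so only the `i`-th term of the relation
    -- contributes.
    have h := congrArg (fun w => B.repr w (⟨r - 1 - i + k, by omega⟩, ⟨s - 1 - k, by omega⟩)) hg
    have hrepr (i' : Fin r) := repr_sum_smul hx hy B hB (r + s - 2 - 2 * (i' : ℕ) + i')
      (fun a => ∑ j : Fin (i' + 1), c i' j * ((r + s - 2 - 2 * (i' : ℕ) + j).choose a : F))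
      ⟨r - 1 - i + k, by omega⟩ ⟨s - 1 - k, by omega⟩
    simp only [← add_pow_mul_sum_smul] at hrepr
    rw [map_sum, Finsupp.finsetSum_apply, Finset.sum_eq_single i] at h
    · rw [map_smul, Finsupp.smul_apply, hrepr, if_pos (by omega), map_zero, Finsupp.zero_apply,
        smul_eq_mul] at h
      exact (mul_eq_zero.1 h).resolve_right hk
    · intro i' _ hi'
      have := i'.2
      rw [map_smul, Finsupp.smul_apply, hrepr, if_neg, smul_zero]
      exact fun h' => hi' (Fin.ext (by omega))
    · simp

end Strings

/-! ### The Jordan canonical form of the tensor product -/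

theorem isJordanPartition_of_basis {F V m : Type*} [Field F] [AddCommGroup V] [Module F V]
    [Fintype m] [DecidableEq m] {lam : List ℕ} (hlam : lam.Pairwise (· ≥ ·))
    (hpos : ∀ a ∈ lam, 0 < a) (f : V →ₗ[F] V) {A : Matrix m m F} (B : Module.Basis m F V)
    (hB : ∀ j, f (B j) = ∑ i, A i j • B i)
    (C : Module.Basis (Σ i : Fin lam.length, Fin (lam.get i)) F V)
    (hC : ∀ j, f (C j) = ∑ i, jordanSum F lam i j • C i) : IsJordanPartition A lam := by
  have hA : LinearMap.toMatrix B B f = A := by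
    rw [show f = Matrix.toLin B B A from B.ext fun j => by rw [hB, Matrix.toLin_self],
      LinearMap.toMatrix_toLin]
  have hJ : LinearMap.toMatrix C C f = jordanSum F lam := by
    rw [show f = Matrix.toLin C C (jordanSum F lam) from
      C.ext fun j => by rw [hC, Matrix.toLin_self], LinearMap.toMatrix_toLin]
  refine ⟨hlam, hpos, B.toMatrix C, C.toMatrix B, B.toMatrix_mul_toMatrix_flip C,
    C.toMatrix_mul_toMatrix_flip B, ?_⟩
  rw [← hA, ← hJ, basis_toMatrix_mul_linearMap_toMatrix_mul_basis_toMatrix]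

/-- Powers descend because the `1`s of `jordanBlock` lie above the diagonal: column `j` involves `j`
and `j - 1`. The hypothesis `h` is the case `j = 0`. -/
theorem one_add_mul_pow_mul {F A : Type*} [Field F] [CommRing A] [Algebra F A] {n : ℕ} {z v : A}
    (h : z ^ n * v = 0) (j : Fin n) :
    (1 + z) * (z ^ (n - 1 - j) * v) =
      ∑ i : Fin n, jordanBlock F n i j • (z ^ (n - 1 - i) * v) := by
  obtain ⟨j, hj⟩ := j
  have hsplit (i : Fin n) : jordanBlock F n i ⟨j, hj⟩ • (z ^ (n - 1 - i) * v) =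
      (if i = ⟨j, hj⟩ then z ^ (n - 1 - i) * v else 0) +
        if j = (i : ℕ) + 1 then z ^ (n - 1 - i) * v else 0 := by
    simp only [jordanBlock, Matrix.of_apply, Fin.ext_iff]
    by_cases h1 : j = i
    · simp [h1]
    · simp [h1, Ne.symm h1, ite_smul]
  simp only [hsplit, Finset.sum_add_distrib, Finset.sum_ite_eq', Finset.mem_univ, if_true]
  rw [add_mul, one_mul, ← mul_assoc, ← pow_succ']
  congr 1
  rcases j with _ | j
  · rw [show n - 1 - 0 + 1 = n by omega, h]
    simp
  · rw [Finset.sum_eq_single ⟨j, by omega⟩]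
    · rw [if_pos rfl, show n - 1 - (j + 1) + 1 = n - 1 - j by omega]
    · intro b _ hb
      rw [if_neg fun h' => hb (Fin.ext (by simp only; omega))]
    · simp

/-- `A` is built as a tower over `R = F[x] / (x ^ r)`. There `1 + x` is a unit, so the second basis
rescales `y ^ b` by `(1 + x) ^ b` over `R`. -/
theorem exists_algebra_basis_pow_mul_pow.{u} (F : Type u) [Field F] {r : ℕ} (hr : r ≠ 0) (s : ℕ) :
    ∃ (A : Type u) (_ : CommRing A) (_ : Algebra F A) (x y : A), x ^ r = 0 ∧ y ^ s = 0 ∧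
      (∃ B : Module.Basis (Fin r × Fin s) F A, ∀ q, B q = x ^ (q.1 : ℕ) * y ^ (q.2 : ℕ)) ∧
      ∃ B : Module.Basis (Fin r × Fin s) F A,
        ∀ q, B q = x ^ (q.1 : ℕ) * (y * (1 + x)) ^ (q.2 : ℕ) := by
  have hm : (Polynomial.X ^ r : Polynomial F).Monic := Polynomial.monic_X_pow r
  let R := AdjoinRoot (Polynomial.X ^ r : Polynomial F)
  have : Nontrivial R := AdjoinRoot.nontrivial _ (by simpa using hr)
  have hm' : (Polynomial.X ^ s : Polynomial R).Monic := Polynomial.monic_X_pow s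
  let A := AdjoinRoot (Polynomial.X ^ s : Polynomial R)
  let x : R := AdjoinRoot.root _
  let y : A := AdjoinRoot.root _
  have hx : x ^ r = 0 := by
    have := AdjoinRoot.eval₂_root (Polynomial.X ^ r : Polynomial F)
    simpa using this
  have hy : y ^ s = 0 := by
    have := AdjoinRoot.eval₂_root (Polynomial.X ^ s : Polynomial R)
    simpa using this
  let b₁ : Module.Basis (Fin r) F R := (AdjoinRoot.powerBasis' hm).basis.reindex
    (finCongr (by simp))
  let b₂ : Module.Basis (Fin s) R A := (AdjoinRoot.powerBasis' hm').basis.reindex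
    (finCongr (by simp))
  have hb₁ (a) : b₁ a = x ^ (a : ℕ) := by simp [b₁, x]
  have hb₂ (a) : b₂ a = y ^ (a : ℕ) := by simp [b₂, y]
  have hu : IsUnit (1 + x) := IsNilpotent.isUnit_one_add ⟨r, hx⟩
  refine ⟨A, inferInstance, inferInstance, algebraMap R A x, y, ?_, hy, ⟨b₁.smulTower b₂, ?_⟩,
    b₁.smulTower (b₂.unitsSMul fun b => hu.unit ^ (b : ℕ)), ?_⟩
  · rw [← map_pow, hx, map_zero]
  · intro q
    rw [Module.Basis.smulTower_apply, hb₁, hb₂, Algebra.smul_def, map_pow]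
  · intro q
    rw [Module.Basis.smulTower_apply, Module.Basis.unitsSMul_apply, hb₁, hb₂, Units.smul_def,
      Algebra.smul_def, Algebra.smul_def, map_pow, Units.val_pow_eq_pow_val, map_pow,
      IsUnit.unit_spec, map_add, map_one, mul_pow, mul_comm (y ^ _)]

theorem standardPartition_get {r s : ℕ} (i : Fin (standardPartition r s).length) :
    (standardPartition r s).get i = r + s - 1 - 2 * (i : ℕ) := by
  have h : (standardPartition r s).get i = r + s + 1 - 2 * ((i : ℕ) + 1) := by
    rw [List.get_eq_getElem]
    exact List.getElem_ofFn _
  omega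

theorem length_standardPartition (r s : ℕ) : (standardPartition r s).length = r := by
  simp [standardPartition]

theorem pairwise_standardPartition (r s : ℕ) : (standardPartition r s).Pairwise (· ≥ ·) := by
  rw [standardPartition, List.pairwise_ofFn]
  intro i j hij
  have : (i : ℕ) < j := hij
  omega

theorem pos_of_mem_standardPartition {r s : ℕ} (hrs : r ≤ s) :
    ∀ a ∈ standardPartition r s, 0 < a := by
  simp only [standardPartition, List.mem_ofFn]
  rintro _ ⟨i, rfl⟩
  have := i.2
  omega

theorem card_sigma_standardPartition {r s : ℕ} (hrs : r ≤ s) :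
    Fintype.card (Σ i : Fin (standardPartition r s).length, Fin ((standardPartition r s).get i)) =
      r * s := by
  simp only [Fintype.card_sigma, Fintype.card_fin, standardPartition_get]
  rw [Fin.sum_univ_eq_sum_range (fun i => r + s - 1 - 2 * i), length_standardPartition]
  have key : ∀ k ≤ r, ∑ i ∈ Finset.range k, (r + s - 1 - 2 * i) + k * k = k * (r + s) := by
    intro k
    induction k with
    | zero => simp
    | succ k ih =>
      intro hk
      have h1 := ih (by omega)
      rw [Finset.sum_range_succ]
      have h2 : r + s - 1 - 2 * k + (2 * k + 1) = r + s := by omega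
      nlinarith
  have := key r le_rfl
  nlinarith

theorem isJordanPartition_standardPartition {p : ℕ} (hp : p ≠ 0) (F : Type*) [Field F] [CharP F p]
    {r s : ℕ} (hr : r ≠ 0) (hrs : r ≤ s)
    (hs : ∀ j : ℤ, |j| ≤ (r : ℤ) - 2 → ¬ (s : ℤ) ≡ j [ZMOD (p : ℤ)]) :
    IsJordanPartition (Matrix.kronecker (jordanBlock F r) (jordanBlock F s))
      (standardPartition r s) := by
  obtain ⟨A, _, _, x, y, hx, hy, ⟨B, hB⟩, B', hB'⟩ := exists_algebra_basis_pow_mul_pow F hr s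
  have hy' : (y * (1 + x)) ^ s = 0 := by rw [mul_pow, hy, zero_mul]
  -- The role of `y` is played by `y * (1 + x)`, which makes `x + y * (1 + x) = (1 + x) * (1 + y) -
  -- 1`.
  obtain ⟨v, hv, hli⟩ := exists_strings hp hrs hs hx hy' B' hB'
  set z := x + y * (1 + x) with hz
  let e : Fin (standardPartition r s).length ≃ Fin r := finCongr (length_standardPartition r s)
  have hv' (i : Fin (standardPartition r s).length) :
      z ^ (standardPartition r s).get i * v (e i) = 0 := by
    rw [standardPartition_get]
    exact hv (e i)
  have hli' := linearIndependent_pow_mul_of_linearIndependent (F := F) z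
    (standardPartition r s).get (fun i => v (e i)) hv' (by
      refine (linearIndependent_equiv' e ?_).2 hli
      funext i
      simp only [Function.comp_apply, standardPartition_get]
      congr 2
      simp only [e, finCongr_apply, Fin.val_cast]
      omega)
  have hcard := card_sigma_standardPartition hrs
  have hfin : Module.finrank F A = r * s := by
    rw [Module.finrank_eq_card_basis B]; simp
  have : Nonempty
      (Σ i : Fin (standardPartition r s).length, Fin ((standardPartition r s).get i)) := by
    rw [← Fintype.card_pos_iff, hcard]
    exact Nat.mul_pos (by omega) (by omega)
  refine isJordanPartition_of_basis (pairwise_standardPartition r s)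
    (pos_of_mem_standardPartition hrs) (LinearMap.mulLeft F (1 + z))
    -- Both exponents are reversed to match the descending powers of `one_add_mul_pow_mul`.
    (B.reindex (Equiv.prodCongr Fin.revPerm Fin.revPerm)) ?_
    (basisOfLinearIndependentOfCardEqFinrank hli' (hcard.trans hfin.symm)) ?_
  · rintro ⟨a, b⟩
    have hval {n : ℕ} (i : Fin n) : ((Fin.rev i : Fin n) : ℕ) = n - 1 - i := by
      rw [Fin.val_rev]; omega
    have h1 := one_add_mul_pow_mul (F := F) (z := x) (v := 1) (by rw [hx, zero_mul]) a
    have h2 := one_add_mul_pow_mul (F := F) (z := y) (v := 1) (by rw [hy, zero_mul]) b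
    simp only [mul_one] at h1 h2
    simp only [Module.Basis.reindex_apply, hB, LinearMap.mulLeft_apply, Equiv.prodCongr_symm,
      Equiv.prodCongr_apply, Prod.map_fst, Prod.map_snd, Fin.revPerm_symm, Fin.revPerm_apply, hval]
    rw [show (1 + z) * (x ^ (r - 1 - (a : ℕ)) * y ^ (s - 1 - (b : ℕ))) =
      ((1 + x) * x ^ (r - 1 - (a : ℕ))) * ((1 + y) * y ^ (s - 1 - (b : ℕ))) by rw [hz]; ring,
      h1, h2, Finset.sum_mul_sum, Fintype.sum_prod_type]
    simp only [smul_mul_smul_comm, Matrix.kronecker, Matrix.kroneckerMap_apply]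
  · rintro ⟨i, l⟩
    simp only [coe_basisOfLinearIndependentOfCardEqFinrank, LinearMap.mulLeft_apply]
    rw [one_add_mul_pow_mul (F := F) (hv' i) l, Fintype.sum_sigma, Finset.sum_eq_single i]
    · simp only [jordanSum, Matrix.blockDiagonal'_apply_eq]
    · intro i' _ hi'
      refine Finset.sum_eq_zero fun l' _ => ?_
      rw [jordanSum, Matrix.blockDiagonal'_apply_ne _ _ _ hi', zero_smul]
    · simp

theorem mainTheorem2 (p : ℕ) (hp : p.Prime) (F : Type*) [Field F] [CharP F p]
    (r s : ℕ) (hr : 1 ≤ r) (hrs : r ≤ s)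
    (hs : ∀ j : ℤ, |j| ≤ (r : ℤ) - 2 → ¬ (s : ℤ) ≡ j [ZMOD (p : ℤ)]) :
    jordanPartition F r s = standardPartition r s :=
  jordanPartition_eq
    (isJordanPartition_standardPartition hp.ne_zero F (Nat.one_le_iff_ne_zero.1 hr) hrs hs)
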